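/- Let $\nu$ be a Borel probability measure on the circle $\mathbb T=\mathbb R/\mathbb Z$, let $\mu$ be the normalized Haar (Lebesgue) measure on $\mathbb T$, and let $P_\nu f(x)=(\nu*f)(x)=\int_{\mathbb T} f(x-y)\,d\nu(y)$. Assume that $P_\nu$ is hyperbounded, i.e. for some $1\le p<q\le\infty$ it maps $L^p(\mathbb T,\mu)$ into $L^q(\mathbb T,\mu)$; the measure $\nu$ may be singular with respect to $\mu$. Let $(n_k)_{k\ge1}$ be a (not necessarily monotone) sequence of distinct positive integers with bounded gaps, i.e. $\sup_{k\ge 1}|n_{k+1}-n_k|<\infty$. Then for $\nu$-almost every $x$ the sequence $(n_kx)_{k\ge1}$ is uniformly distributed modulo $1$; that is, for all $0\le a<b\le1$, $$\lim_{N\to\infty}\frac1N\sum_{k=1}^N 1_{[a,b)}(\{n_kx\})=b-a,$$ where $\{\cdot\}$ denotes the fractional part (which does not depend on the real representative of $x$, since the $n_k$ are integers). -/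

import Mathlib

open MeasureTheory Filter Topology
open scoped ENNReal

/-- The convolution operator `P_ν f = ν * f` on the circle `ℝ/ℤ`:
`P_ν f (x) = ∫ f (x - y) dν(y)`. -/
noncomputable def convOp (ν : Measure UnitAddCircle) (f : UnitAddCircle → ℂ) :
    UnitAddCircle → ℂ :=
  fun x => ∫ y, f (x - y) ∂ν

/-- `P_ν` is hyperbounded: for some `1 ≤ p < q ≤ ∞` it maps `L^p` into `L^q`, the Lebesgue
spaces being taken with respect to the normalized Haar measure of the circle. -/
def IsHyperboundedConv (ν : Measure UnitAddCircle) : Prop :=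
  ∃ p q : ℝ≥0∞, 1 ≤ p ∧ p < q ∧
    ∀ f : UnitAddCircle → ℂ, MemLp f p AddCircle.haarAddCircle →
      MemLp (convOp ν f) q AddCircle.haarAddCircle

/-- Uniform distribution modulo 1 of a sequence of reals (indexed from `0`). -/
def UniformlyDistributedMod1 (u : ℕ → ℝ) : Prop :=
  ∀ a b : ℝ, 0 ≤ a → a < b → b ≤ 1 →
    Tendsto
      (fun N : ℕ => (1 / (N : ℝ)) *
        ∑ k ∈ Finset.range N, (Set.Ico a b).indicator (fun _ => (1 : ℝ)) (Int.fract (u k)))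
      atTop (𝓝 (b - a))

/-- Bounded gaps: the consecutive differences `|n (k+1) - n k|` are bounded. The sequence is
not required to be monotone. -/
def HasBoundedGaps (n : ℕ → ℕ) : Prop :=
  ∃ d : ℕ, ∀ k : ℕ, |(n (k + 1) : ℤ) - (n k : ℤ)| ≤ (d : ℤ)

/-! Hyperboundedness enters only through a Frostman bound `ν(B(x, δ)) ≤ C δ ^ s`: a convolution
operator that improves integrability cannot come from a measure too concentrated on small balls, as
the test function `‖t‖ ^ (-α)` shows (`IsHyperboundedConv.exists_measureReal_closedBall_le`).

The Frostman bound makes the coefficients `ν̂(m)` small in quadratic mean: over `|m| ≤ M` the sum of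
`|ν̂(m)|²` is `O(M ^ (1 - s / 2))` (`sum_norm_sq_fourierStieltjes_le`). Bounded gaps keep all
differences `n j - n k`, `j, k < N`, within `O(N)`, and for fixed `j` they are distinct. Hence
Cauchy–Schwarz bounds the `L²(ν)` norm of the exponential sum: `∫ |S_N|² dν = ∑ ν̂(n j - n k) = O(N
^ (2 - s / 4))`.

So `|S_N / N|²` has summable integrals along `N = ⌊c ^ m⌋`, whence a.e. convergence to zero there;
letting `c → 1` fills in the remaining `N`. Applying this to the sequences `m * n k`, `m ≠ 0`, gives
Weyl's criterion off one null set. -/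

/-! ### Weyl's criterion on the circle -/

theorem UnitAddCircle.volume_eq_haarAddCircle :
    (volume : Measure UnitAddCircle) = AddCircle.haarAddCircle := by
  simp [AddCircle.volume_eq_smul_haarAddCircle]

instance UnitAddCircle.nullSingletonClass_haarAddCircle :
    NullSingletonClass (AddCircle.haarAddCircle : Measure UnitAddCircle) where
  measure_singleton y := by
    rw [← UnitAddCircle.volume_eq_haarAddCircle, ← Metric.closedBall_zero,
      AddCircle.volume_closedBall]
    simp

theorem integral_fourier_haarAddCircle {m : ℤ} (hm : m ≠ 0) :
    ∫ x : UnitAddCircle, fourier m x ∂AddCircle.haarAddCircle = 0 := by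
  have h := congrFun (fourierCoeff_fourier (T := (1 : ℝ)) m) 0
  simpa [fourierCoeff, Pi.single_apply, hm.symm] using h

/-- Weyl's criterion, for continuous test functions. -/
theorem tendsto_average_of_tendsto_fourier {x : ℕ → UnitAddCircle}
    (h : ∀ m : ℤ, m ≠ 0 →
      Tendsto (fun N : ℕ => (N : ℂ)⁻¹ * ∑ k ∈ Finset.range N, fourier m (x k)) atTop (𝓝 0))
    (f : C(UnitAddCircle, ℂ)) :
    Tendsto (fun N : ℕ => (N : ℂ)⁻¹ * ∑ k ∈ Finset.range N, f (x k)) atTop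
      (𝓝 (∫ y, f y ∂AddCircle.haarAddCircle)) := by
  have hint : ∀ g : C(UnitAddCircle, ℂ), Integrable (fun y => g y) AddCircle.haarAddCircle :=
    fun g => g.continuous.integrable_of_hasCompactSupport (HasCompactSupport.of_compactSpace _)
  have hspan : ∀ g ∈ Submodule.span ℂ (Set.range (@fourier (1 : ℝ))),
      Tendsto (fun N : ℕ => (N : ℂ)⁻¹ * ∑ k ∈ Finset.range N, g (x k)) atTop
        (𝓝 (∫ y, g y ∂AddCircle.haarAddCircle)) := by
    intro g hg
    induction hg using Submodule.span_induction with
    | mem g hg =>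
      obtain ⟨m, rfl⟩ := hg
      by_cases hm : m = 0
      · subst hm
        simp only [fourier_zero, Finset.sum_const, Finset.card_range, nsmul_eq_mul, mul_one,
          integral_const, probReal_univ, one_smul]
        refine tendsto_const_nhds.congr' ?_
        filter_upwards [eventually_gt_atTop 0] with N hN
        rw [inv_mul_cancel₀ (by exact_mod_cast hN.ne')]
      · rw [integral_fourier_haarAddCircle hm]
        exact h m hm
    | zero => simp
    | add g₁ g₂ _ _ h₁ h₂ =>
      have := h₁.add h₂
      rw [← integral_add (hint g₁) (hint g₂)] at this
      simpa [Finset.sum_add_distrib, mul_add] using this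
    | smul c g _ hg =>
      have := hg.const_mul c
      rw [← integral_const_mul] at this
      refine this.congr fun N => ?_
      simp only [ContinuousMap.smul_apply, smul_eq_mul, ← Finset.mul_sum]
      ring
  have hf : f ∈ closure (Submodule.span ℂ (Set.range (@fourier (1 : ℝ))) :
      Set C(UnitAddCircle, ℂ)) := by
    rw [← Submodule.topologicalClosure_coe, span_fourier_closure_eq_top]
    trivial
  rw [Metric.tendsto_atTop]
  intro ε hε
  obtain ⟨g, hg, hfg⟩ := Metric.mem_closure_iff.1 hf (ε / 3) (by positivity)
  obtain ⟨N₀, hN₀⟩ := Metric.tendsto_atTop.1 (hspan g hg) (ε / 3) (by positivity)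
  have hpt : ∀ y, ‖f y - g y‖ ≤ ε / 3 := fun y => by
    rw [← dist_eq_norm]
    exact (ContinuousMap.dist_apply_le_dist y).trans hfg.le
  refine ⟨N₀, fun N hN => ?_⟩
  have h1 : ‖(N : ℂ)⁻¹ * ∑ k ∈ Finset.range N, f (x k) -
      (N : ℂ)⁻¹ * ∑ k ∈ Finset.range N, g (x k)‖ ≤ ε / 3 := by
    rw [← mul_sub, ← Finset.sum_sub_distrib, norm_mul, norm_inv, Complex.norm_natCast]
    have : ‖∑ k ∈ Finset.range N, (f (x k) - g (x k))‖ ≤ N * (ε / 3) := by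
      refine (norm_sum_le_of_le _ fun k _ => hpt (x k)).trans ?_
      simp
    rcases Nat.eq_zero_or_pos N with rfl | hpos
    · simpa using (by positivity : (0 : ℝ) ≤ ε / 3)
    · have : (0 : ℝ) < N := by exact_mod_cast hpos
      rw [inv_mul_le_iff₀ this]
      assumption
  have h2 := hN₀ N hN
  have h3 : ‖∫ y, g y ∂AddCircle.haarAddCircle - ∫ y, f y ∂AddCircle.haarAddCircle‖ ≤ ε / 3 := by
    rw [← integral_sub (hint g) (hint f)]
    refine (norm_integral_le_of_norm_le_const (C := ε / 3) (ae_of_all _ fun y => ?_)).trans ?_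
    · rw [norm_sub_rev]
      exact hpt y
    · simp
  rw [dist_eq_norm] at h2 ⊢
  have e : (N : ℂ)⁻¹ * ∑ k ∈ Finset.range N, f (x k) - ∫ y, f y ∂AddCircle.haarAddCircle =
      ((N : ℂ)⁻¹ * ∑ k ∈ Finset.range N, f (x k) - (N : ℂ)⁻¹ * ∑ k ∈ Finset.range N, g (x k)) +
      ((N : ℂ)⁻¹ * ∑ k ∈ Finset.range N, g (x k) - ∫ y, g y ∂AddCircle.haarAddCircle) +
      (∫ y, g y ∂AddCircle.haarAddCircle - ∫ y, f y ∂AddCircle.haarAddCircle) := by ring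
  rw [e]
  have := norm_add₃_le (a := (N : ℂ)⁻¹ * ∑ k ∈ Finset.range N, f (x k) -
      (N : ℂ)⁻¹ * ∑ k ∈ Finset.range N, g (x k))
    (b := (N : ℂ)⁻¹ * ∑ k ∈ Finset.range N, g (x k) - ∫ y, g y ∂AddCircle.haarAddCircle)
    (c := ∫ y, g y ∂AddCircle.haarAddCircle - ∫ y, f y ∂AddCircle.haarAddCircle)
  linarith

/-- The Haar probability measure of the circle. -/
noncomputable def haarProbability : ProbabilityMeasure UnitAddCircle :=
  ⟨AddCircle.haarAddCircle, inferInstance⟩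

theorem coe_haarProbability :
    (haarProbability : Measure UnitAddCircle) = AddCircle.haarAddCircle := rfl

/-- The uniform probability measure on the first `N + 1` terms of a sequence. -/
noncomputable def empiricalMeasure (x : ℕ → UnitAddCircle) (N : ℕ) : Measure UnitAddCircle :=
  ((N + 1 : ℕ) : ℝ≥0∞)⁻¹ • ∑ k ∈ Finset.range (N + 1), Measure.dirac (x k)

instance (x : ℕ → UnitAddCircle) (N : ℕ) : IsProbabilityMeasure (empiricalMeasure x N) := by
  constructor
  simp only [empiricalMeasure, Measure.smul_apply, Measure.coe_finsetSum, Finset.sum_apply,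
    measure_univ, Finset.sum_const, Finset.card_range, smul_eq_mul, nsmul_eq_mul, mul_one]
  exact ENNReal.inv_mul_cancel (by simp) (ENNReal.natCast_ne_top _)

/-- `empiricalMeasure` as a bundled probability measure. -/
noncomputable def empiricalProbability (x : ℕ → UnitAddCircle) (N : ℕ) :
    ProbabilityMeasure UnitAddCircle :=
  ⟨empiricalMeasure x N, inferInstance⟩

theorem coe_empiricalProbability (x : ℕ → UnitAddCircle) (N : ℕ) :
    (empiricalProbability x N : Measure UnitAddCircle) = empiricalMeasure x N := rfl

theorem integral_empiricalMeasure {E : Type*} [NormedAddCommGroup E] [NormedSpace ℝ E]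
    [CompleteSpace E] (x : ℕ → UnitAddCircle) (N : ℕ)
    (f : UnitAddCircle → E) :
    ∫ y, f y ∂empiricalMeasure x N =
      ((N + 1 : ℕ) : ℝ)⁻¹ • ∑ k ∈ Finset.range (N + 1), f (x k) := by
  rw [empiricalMeasure, integral_smul_measure, integral_finsetSum_measure]
  · simp only [integral_dirac, ENNReal.toReal_inv, ENNReal.toReal_natCast]
  · intro k _
    exact integrable_dirac (by simp)

theorem tendsto_empiricalProbability_of_tendsto_fourier {x : ℕ → UnitAddCircle}
    (h : ∀ m : ℤ, m ≠ 0 →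
      Tendsto (fun N : ℕ => (N : ℂ)⁻¹ * ∑ k ∈ Finset.range N, fourier m (x k)) atTop (𝓝 0)) :
    Tendsto (empiricalProbability x) atTop (𝓝 haarProbability) := by
  rw [ProbabilityMeasure.tendsto_iff_forall_integral_tendsto]
  intro f
  have := (tendsto_average_of_tendsto_fourier h
    ⟨fun y => ((f y : ℝ) : ℂ), by fun_prop⟩).comp (tendsto_add_atTop_nat 1)
  have := (Complex.continuous_re.tendsto _).comp this
  simp only [ContinuousMap.coe_mk, integral_complex_ofReal, Complex.ofReal_re,
    coe_empiricalProbability, coe_haarProbability, integral_empiricalMeasure] at this ⊢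
  refine this.congr fun N => ?_
  simp only [Function.comp, smul_eq_mul]
  rw [← Complex.ofReal_re (((N + 1 : ℕ) : ℝ)⁻¹ * _)]
  push_cast
  rfl

theorem coe_mem_image_Ico_iff {a b u : ℝ} (ha : 0 ≤ a) (hb : b ≤ 1) :
    (u : UnitAddCircle) ∈ ((↑) : ℝ → UnitAddCircle) '' Set.Ico a b ↔
      Int.fract u ∈ Set.Ico a b := by
  constructor
  · rintro ⟨c, hc, hcu⟩
    have h1 : Int.fract c = Int.fract u := by
      rw [Int.fract_eq_fract]
      obtain ⟨m, hm⟩ := (QuotientAddGroup.eq_iff_sub_mem.1 hcu)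
      exact ⟨m, by simpa using hm.symm⟩
    rw [← h1, Int.fract_eq_self.2 ⟨ha.trans hc.1, hc.2.trans_le hb⟩]
    exact hc
  · intro hu
    refine ⟨_, hu, ?_⟩
    refine QuotientAddGroup.eq_iff_sub_mem.2 ⟨-⌊u⌋, ?_⟩
    rw [← Int.self_sub_floor]
    simp

theorem haarAddCircle_image_Ico {a b : ℝ} (ha : 0 ≤ a) (hb : b ≤ 1) :
    AddCircle.haarAddCircle (((↑) : ℝ → UnitAddCircle) '' Set.Ico a b) =
      ENNReal.ofReal (b - a) := by
  have hmeas : MeasurableSet (((↑) : ℝ → UnitAddCircle) '' Set.Ico a b) := by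
    -- The image is a compact arc minus the point `b`, except that `b` itself belongs to it when `b
    -- = a + 1`; the second term covers that case.
    have : ((↑) : ℝ → UnitAddCircle) '' Set.Ico a b =
        ((↑) '' Set.Icc a b) \ {(b : UnitAddCircle)} ∪
          ((↑) '' Set.Ico a b) ∩ {(b : UnitAddCircle)} := by
      ext y
      constructor
      · intro hy
        by_cases hyb : y = b
        · exact Or.inr ⟨hy, hyb⟩
        · exact Or.inl ⟨Set.image_mono Set.Ico_subset_Icc_self hy, hyb⟩
      · rintro (⟨⟨c, hc, rfl⟩, hyb⟩ | hy)
        · refine ⟨c, ⟨hc.1, lt_of_le_of_ne hc.2 ?_⟩, rfl⟩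
          rintro rfl
          exact hyb rfl
        · exact hy.1
    rw [this]
    refine ((isCompact_Icc.image (AddCircle.continuous_mk' 1)).isClosed.measurableSet.diff
      (measurableSet_singleton _)).union ?_
    exact (Set.Subsingleton.anti Set.subsingleton_singleton Set.inter_subset_right).measurableSet
  rw [← UnitAddCircle.volume_eq_haarAddCircle,
    ← (UnitAddCircle.measurePreserving_mk 0).measure_preimage hmeas.nullMeasurableSet,
    Measure.restrict_apply (hmeas.preimage AddCircle.measurable_mk'), ← Real.volume_Ico]
  refine measure_congr ?_
  -- The fundamental domain is `(0, 1]` while `Int.fract` takes values in `[0, 1)`; they differ by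
  -- two null points.
  have h1 : ∀ᵐ u : ℝ, u ≠ 0 := by simp [ae_iff]
  have h2 : ∀ᵐ u : ℝ, u ≠ 1 := by simp [ae_iff]
  filter_upwards [h1, h2] with u hu0 hu1
  refine propext ?_
  change ((u : UnitAddCircle) ∈ ((↑) : ℝ → UnitAddCircle) '' Set.Ico a b ∧
    u ∈ Set.Ioc (0 : ℝ) (0 + 1)) ↔ u ∈ Set.Ico a b
  rw [coe_mem_image_Ico_iff ha hb]
  constructor
  · rintro ⟨h, h0, h1⟩
    rwa [Int.fract_eq_self.2 ⟨h0.le, lt_of_le_of_ne (by linarith) hu1⟩] at h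
  · intro h
    have h0 : 0 ≤ u := ha.trans h.1
    have h1 : u < 1 := h.2.trans_le hb
    exact ⟨by rwa [Int.fract_eq_self.2 ⟨h0, h1⟩], lt_of_le_of_ne h0 hu0.symm, by linarith⟩

theorem frontier_image_Ico_subset (a b : ℝ) :
    frontier (((↑) : ℝ → UnitAddCircle) '' Set.Ico a b) ⊆
      {(a : UnitAddCircle), (b : UnitAddCircle)} := by
  have hcl : closure (((↑) : ℝ → UnitAddCircle) '' Set.Ico a b) ⊆ (↑) '' Set.Icc a b :=
    closure_minimal (Set.image_mono Set.Ico_subset_Icc_self)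
      (isCompact_Icc.image (AddCircle.continuous_mk' 1)).isClosed
  have hint : ((↑) : ℝ → UnitAddCircle) '' Set.Ioo a b ⊆ interior ((↑) '' Set.Ico a b) :=
    interior_maximal (Set.image_mono Set.Ioo_subset_Ico_self)
      (QuotientAddGroup.isOpenMap_coe _ isOpen_Ioo)
  rintro y ⟨hy1, hy2⟩
  obtain ⟨c, hc, rfl⟩ := hcl hy1
  by_cases hca : c = a
  · simp [hca]
  by_cases hcb : c = b
  · simp [hcb]
  exact absurd (hint ⟨c, ⟨lt_of_le_of_ne hc.1 (Ne.symm hca), lt_of_le_of_ne hc.2 hcb⟩, rfl⟩) hy2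

/-- Weyl's criterion. -/
theorem uniformlyDistributedMod1_of_tendsto_fourier {u : ℕ → ℝ}
    (h : ∀ m : ℤ, m ≠ 0 →
      Tendsto (fun N : ℕ => (N : ℂ)⁻¹ * ∑ k ∈ Finset.range N, fourier m (u k : UnitAddCircle))
        atTop (𝓝 0)) :
    UniformlyDistributedMod1 u := by
  intro a b ha hab hb
  have hfr : (haarProbability : Measure UnitAddCircle)
      (frontier (((↑) : ℝ → UnitAddCircle) '' Set.Ico a b)) = 0 :=
    measure_mono_null (frontier_image_Ico_subset a b)
      ((Set.toFinite _).measure_zero AddCircle.haarAddCircle)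
  have key := ProbabilityMeasure.tendsto_measure_of_null_frontier_of_tendsto'
    (tendsto_empiricalProbability_of_tendsto_fourier h)
    (E := ((↑) : ℝ → UnitAddCircle) '' Set.Ico a b)
    hfr
  simp only [coe_empiricalProbability, coe_haarProbability, haarAddCircle_image_Ico ha hb] at key
  have key := (ENNReal.tendsto_toReal ENNReal.ofReal_ne_top).comp key
  rw [ENNReal.toReal_ofReal (by linarith)] at key
  -- The empirical measures average `N + 1` terms, so that each is a probability measure; hence the
  -- shift.
  rw [← tendsto_add_atTop_iff_nat 1]
  refine key.congr fun N => ?_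
  have : ∀ k, Measure.dirac (u k : UnitAddCircle) (((↑) : ℝ → UnitAddCircle) '' Set.Ico a b) =
      ENNReal.ofReal ((Set.Ico a b).indicator (fun _ => (1 : ℝ)) (Int.fract (u k))) := by
    intro k
    rw [Measure.dirac_apply]
    by_cases hk : Int.fract (u k) ∈ Set.Ico a b
    · rw [Set.indicator_of_mem ((coe_mem_image_Ico_iff ha hb).2 hk), Set.indicator_of_mem hk]
      simp
    · rw [Set.indicator_of_notMem (fun h => hk ((coe_mem_image_Ico_iff ha hb).1 h)),
        Set.indicator_of_notMem hk]
      simp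
  simp only [Function.comp, empiricalMeasure, Measure.smul_apply, Measure.coe_finsetSum,
    Finset.sum_apply, this, smul_eq_mul, ENNReal.toReal_mul, ENNReal.toReal_inv,
    ENNReal.toReal_natCast, one_div]
  rw [← ENNReal.ofReal_sum_of_nonneg, ENNReal.toReal_ofReal]
  · exact Finset.sum_nonneg fun k _ => Set.indicator_nonneg (fun _ _ => zero_le_one) _
  · exact fun k _ => Set.indicator_nonneg (fun _ _ => zero_le_one) _

/-! ### From hyperboundedness to a Frostman condition -/

theorem integrableOn_abs_rpow {r : ℝ} (hr : -1 < r) :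
    IntegrableOn (fun s : ℝ => |s| ^ r) (Set.Ioc (-(1 / 2)) (1 / 2)) := by
  have hpos : IntervalIntegrable (fun s : ℝ => |s| ^ r) volume 0 (1 / 2) := by
    refine (intervalIntegral.intervalIntegrable_rpow' (a := 0) (b := 1 / 2) hr).congr ?_
    intro s hs
    rw [Set.uIoc_of_le (by norm_num)] at hs
    simp [abs_of_pos hs.1]
  have hneg : IntervalIntegrable (fun s : ℝ => |s| ^ r) volume (-(1 / 2)) 0 := by
    have := (IntervalIntegrable.iff_comp_neg (f := fun s : ℝ => |s| ^ r)).1 hpos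
    simpa using this.symm
  exact (intervalIntegrable_iff_integrableOn_Ioc_of_le (by norm_num)).1 (hneg.trans hpos)

theorem measurable_norm_rpow (α : ℝ) : Measurable fun t : UnitAddCircle => ‖t‖ ^ α := by
  fun_prop

theorem memLp_norm_rpow {α : ℝ} {p : ℝ≥0∞} (hp0 : p ≠ 0) (hp : p ≠ ∞)
    (hα : α * p.toReal < 1) :
    MemLp (fun t : UnitAddCircle => ((‖t‖ ^ (-α) : ℝ) : ℂ)) p AddCircle.haarAddCircle := by
  have hm : Measurable fun t : UnitAddCircle => ((‖t‖ ^ (-α) : ℝ) : ℂ) := by fun_prop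
  rw [memLp_haarAddCircle_iff, ← (UnitAddCircle.measurePreserving_mk (-(1 / 2))).map_eq,
    memLp_map_measure_iff hm.aestronglyMeasurable AddCircle.measurable_mk'.aemeasurable,
    ← integrable_norm_rpow_iff (hm.comp AddCircle.measurable_mk').aestronglyMeasurable hp0 hp]
  have h := integrableOn_abs_rpow (r := -(α * p.toReal)) (by linarith)
  have e : (-(1 / 2) : ℝ) + 1 = 1 / 2 := by norm_num
  rw [e]
  refine h.congr_fun ?_ measurableSet_Ioc
  intro s hs
  have hs' : ‖(s : UnitAddCircle)‖ = |s| :=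
    (AddCircle.norm_coe_eq_abs_iff (p := 1) one_ne_zero).2 (by
      rw [abs_le, abs_one]; exact ⟨hs.1.le, hs.2⟩)
  simp only [Function.comp, hs', Complex.norm_real, Real.norm_eq_abs,
    abs_of_nonneg (Real.rpow_nonneg (abs_nonneg s) _), ← Real.rpow_mul (abs_nonneg s), neg_mul]

/-- Tonelli and translation invariance. It is needed because the Bochner integral defining `convOp`
is zero by default where integrability fails, which would void lower bounds. -/
theorem ae_integrable_comp_sub (ν : Measure UnitAddCircle) [IsFiniteMeasure ν]
    {f : UnitAddCircle → ℝ} (hm : Measurable f) (hf : Integrable f AddCircle.haarAddCircle) :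
    ∀ᵐ x ∂AddCircle.haarAddCircle, Integrable (fun y => f (x - y)) ν := by
  have hme : Measurable fun z : UnitAddCircle × UnitAddCircle => ‖f (z.1 - z.2)‖ₑ :=
    (hm.comp (measurable_fst.sub measurable_snd)).enorm
  have h : ∫⁻ x, ∫⁻ y, ‖f (x - y)‖ₑ ∂ν ∂AddCircle.haarAddCircle < ∞ := by
    rw [lintegral_lintegral_swap hme.aemeasurable]
    simp only [lintegral_sub_right_eq_self (fun x => ‖f x‖ₑ), lintegral_const]
    exact ENNReal.mul_lt_top hf.2 (measure_lt_top ν _)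
  filter_upwards [ae_lt_top hme.lintegral_prod_right' h.ne] with x hx
  exact ⟨(hm.comp (measurable_const.sub measurable_id)).aestronglyMeasurable, hx⟩

theorem ae_measure_singleton_eq_zero (ν : Measure UnitAddCircle) [IsFiniteMeasure ν] :
    ∀ᵐ x ∂AddCircle.haarAddCircle, ν {x} = 0 := by
  have hc : {x | 0 < ν {x}}.Countable :=
    Measure.countable_meas_pos_of_disjoint_iUnion (fun x => measurableSet_singleton x)
      (fun x y hxy => by simpa using hxy)
  have h0 : AddCircle.haarAddCircle {x | 0 < ν {x}} = 0 :=
    hc.measure_zero _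
  filter_upwards [measure_eq_zero_iff_ae_notMem.1 h0] with x hx
  simpa using hx

/-- The measure of a hyperbounded convolution operator satisfies a Frostman condition: test the
operator on the power `‖t‖ ^ (-α)` with `1 / q < α < 1 / p`. -/
theorem IsHyperboundedConv.exists_measureReal_closedBall_le {ν : Measure UnitAddCircle}
    [IsProbabilityMeasure ν] (hν : IsHyperboundedConv ν) :
    ∃ C s : ℝ, 0 ≤ C ∧ 0 < s ∧ s ≤ 1 ∧ ∀ (x₀ : UnitAddCircle) (δ : ℝ), 0 < δ → δ ≤ 1 / 2 →
      ν.real (Metric.closedBall x₀ δ) ≤ C * δ ^ s := by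
  obtain ⟨p, q, hp1, hpq, hmap⟩ := hν
  have hp0 : p ≠ 0 := (zero_lt_one.trans_le hp1).ne'
  have hp : p ≠ ∞ := hpq.ne_top
  have hq0 : q ≠ 0 := (pos_of_gt hpq).ne'
  have hp1' : 1 ≤ p.toReal := by
    rw [← ENNReal.toReal_one]; exact ENNReal.toReal_mono hp hp1
  have hlt : 1 / q.toReal < 1 / p.toReal := by
    -- By the defaults `∞.toReal = 0` and `1 / 0 = 0`, `1 / q.toReal` is the correct exponent for `q
    -- = ∞` too.
    by_cases hq : q = ∞
    · subst hq
      simp only [ENNReal.toReal_top, div_zero]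
      positivity
    · exact one_div_lt_one_div_of_lt (by linarith) ((ENNReal.toReal_lt_toReal hp hq).2 hpq)
  obtain ⟨α, hα1, hα2⟩ := exists_between hlt
  have hq0' : 0 ≤ 1 / q.toReal := by positivity
  have hα0 : 0 < α := hq0'.trans_lt hα1
  have hαp : α * p.toReal < 1 := (lt_div_iff₀ (by linarith)).1 hα2
  have hα1' : α < 1 := by nlinarith
  set f : UnitAddCircle → ℝ := fun t => ‖t‖ ^ (-α) with hfdef
  have hfm : Measurable f := measurable_norm_rpow _
  have hF := hmap _ (memLp_norm_rpow hp0 hp hαp)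
  have hfint : Integrable f AddCircle.haarAddCircle := by
    have := (memLp_norm_rpow (α := α) (p := 1) one_ne_zero ENNReal.one_ne_top
      (by simpa using hα1'))
    simpa using (memLp_one_iff_integrable.1 this).re
  set A : ℝ := (eLpNorm (convOp ν fun t => ((f t : ℝ) : ℂ)) q AddCircle.haarAddCircle).toReal
    with hA
  refine ⟨A * 2 ^ (α - 1 / q.toReal), α - 1 / q.toReal, by positivity, by linarith, by linarith,
    fun x₀ δ hδ hδ' => ?_⟩
  set B := Metric.closedBall x₀ δ with hB
  have hBμ : AddCircle.haarAddCircle B = ENNReal.ofReal (2 * δ) := by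
    rw [← UnitAddCircle.volume_eq_haarAddCircle, hB, AddCircle.volume_closedBall,
      min_eq_right (by linarith)]
  -- Two points of `B` are at distance at most `2 * δ`, so `c` bounds the convolution from below
  -- a.e. on `B`. Comparing `L^q` norms gives `c * (2 * δ) ^ (1 / q) ≤ A`, which is the claim.
  set c : ℝ := (2 * δ) ^ (-α) * ν.real B with hc
  have hc0 : 0 ≤ c := by positivity
  have hle : eLpNorm (B.indicator fun _ => c) q AddCircle.haarAddCircle ≤
      eLpNorm (convOp ν fun t => ((f t : ℝ) : ℂ)) q AddCircle.haarAddCircle := by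
    refine eLpNorm_mono_ae ?_
    filter_upwards [ae_integrable_comp_sub ν hfm hfint, ae_measure_singleton_eq_zero ν]
      with x hx hx0
    by_cases hxB : x ∈ B
    · rw [Set.indicator_of_mem hxB, Real.norm_of_nonneg hc0]
      have e1 : convOp ν (fun t => ((f t : ℝ) : ℂ)) x = ((∫ y, f (x - y) ∂ν : ℝ) : ℂ) := by
        simp only [convOp]
        exact integral_ofReal
      have hnn : ∀ y, 0 ≤ f (x - y) := fun y => Real.rpow_nonneg (norm_nonneg _) _
      rw [e1, Complex.norm_real, Real.norm_of_nonneg (integral_nonneg hnn)]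
      -- The point `y = x` must be removed: there `f` takes the default value `0 ^ (-α) = 0` instead
      -- of infinity. Almost every `x` is not an atom of `ν`.
      have e2 : ν.real (B \ {x}) = ν.real B := by
        rw [measureReal_def, measureReal_def, measure_sdiff_null hx0]
      have hmeas : MeasurableSet (B \ {x}) :=
        Metric.isClosed_closedBall.measurableSet.diff (measurableSet_singleton x)
      calc c = ∫ y in B \ {x}, (2 * δ) ^ (-α) ∂ν := by
              rw [setIntegral_const, e2, smul_eq_mul, mul_comm]
        _ ≤ ∫ y in B \ {x}, f (x - y) ∂ν := by
              refine setIntegral_mono_on (integrable_const _).integrableOn hx.integrableOn hmeas ?_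
              rintro y ⟨hy, hyx⟩
              have hpos : 0 < ‖x - y‖ := norm_sub_pos_iff.2 (fun h => hyx h.symm)
              have hle : ‖x - y‖ ≤ 2 * δ := by
                rw [← dist_eq_norm]
                have := dist_triangle_right x y x₀
                have h1 : dist x x₀ ≤ δ := hxB
                have h2 : dist y x₀ ≤ δ := hy
                linarith
              exact Real.rpow_le_rpow_of_nonpos hpos hle (by linarith)
        _ ≤ ∫ y, f (x - y) ∂ν := setIntegral_le_integral hx (ae_of_all _ hnn)
    · rw [Set.indicator_of_notMem hxB, norm_zero]
      exact norm_nonneg _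
  have h2δ : 0 < 2 * δ := by linarith
  rw [eLpNorm_indicator_const' Metric.isClosed_closedBall.measurableSet
    (by rw [hBμ]; simpa using hδ) hq0, hBμ] at hle
  have hle' := ENNReal.toReal_mono hF.2.ne hle
  rw [ENNReal.toReal_mul, toReal_enorm, Real.norm_of_nonneg hc0, ← ENNReal.toReal_rpow,
    ENNReal.toReal_ofReal h2δ.le, ← hA, hc] at hle'
  have e3 : (2 * δ) ^ (-α) * ν.real B * (2 * δ) ^ (1 / q.toReal) =
      ν.real B * (2 * δ) ^ (-(α - 1 / q.toReal)) := by
    rw [neg_sub, sub_eq_add_neg, Real.rpow_add h2δ]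
    ring
  rw [e3, Real.rpow_neg h2δ.le, ← div_eq_mul_inv, div_le_iff₀ (by positivity),
    Real.mul_rpow (by norm_num) hδ.le] at hle'
  linarith

theorem IsHyperboundedConv.exists_measureReal_closedBall_le_of_pos {ν : Measure UnitAddCircle}
    [IsProbabilityMeasure ν] (hν : IsHyperboundedConv ν) :
    ∃ C s : ℝ, 0 ≤ C ∧ 0 < s ∧ s ≤ 1 ∧ ∀ (x₀ : UnitAddCircle) (δ : ℝ), 0 < δ →
      ν.real (Metric.closedBall x₀ δ) ≤ C * δ ^ s := by
  obtain ⟨C, s, hC, hs, hs1, h⟩ := hν.exists_measureReal_closedBall_le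
  -- The extra `2` handles `δ ≥ 1 / 2`, where `2 * δ ^ s ≥ 1` because `s ≤ 1`.
  refine ⟨C + 2, s, by linarith, hs, hs1, fun x₀ δ hδ => ?_⟩
  rcases le_total δ (1 / 2) with hδ' | hδ'
  · have := h x₀ δ hδ hδ'
    have : 0 ≤ δ ^ s := by positivity
    linarith
  · have h1 : (1 / 2 : ℝ) ^ s ≤ δ ^ s := Real.rpow_le_rpow (by norm_num) hδ' hs.le
    have h2 : (1 / 2 : ℝ) ^ (1 : ℝ) ≤ (1 / 2) ^ s :=
      Real.rpow_le_rpow_of_exponent_ge (by norm_num) (by norm_num) hs1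
    rw [Real.rpow_one] at h2
    have : 0 ≤ C * δ ^ s := by positivity
    have := measureReal_le_one (μ := ν) (s := Metric.closedBall x₀ δ)
    linarith

/-! ### Quadratic mean of Fourier–Stieltjes coefficients -/

/-- The Fourier–Stieltjes coefficients of a measure on the circle. -/
noncomputable def fourierStieltjes (ν : Measure UnitAddCircle) (m : ℤ) : ℂ :=
  ∫ x, fourier m x ∂ν

theorem fourier_sub_index (m n : ℤ) (x : UnitAddCircle) :
    fourier (m - n) x = fourier m x * (starRingEnd ℂ) (fourier n x) := by
  rw [sub_eq_add_neg, fourier_add, fourier_neg]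

theorem fourier_sub_apply (m : ℤ) (x y : UnitAddCircle) :
    fourier m (x - y) = fourier m x * (starRingEnd ℂ) (fourier m y) := by
  rw [← fourier_neg, fourier_apply, fourier_apply, fourier_apply, smul_sub, sub_eq_add_neg,
    AddCircle.toCircle_add, neg_smul]
  simp

theorem norm_fourier_apply (m : ℤ) (x : UnitAddCircle) : ‖fourier m x‖ = 1 := by
  rw [fourier_apply, Circle.norm_coe]

theorem integrable_fourier (ν : Measure UnitAddCircle) [IsFiniteMeasure ν] (m : ℤ) :
    Integrable (fun x => fourier m x) ν :=
  (fourier m).continuous.integrable_of_hasCompactSupport (HasCompactSupport.of_compactSpace _)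

theorem norm_sq_sum_fourier {ι : Type*} (s : Finset ι) (n : ι → ℤ) (x : UnitAddCircle) :
    ((‖∑ j ∈ s, fourier (n j) x‖ ^ 2 : ℝ) : ℂ) =
      ∑ j ∈ s, ∑ k ∈ s, fourier (n j - n k) x := by
  push_cast
  rw [← Complex.mul_conj', map_sum, Finset.sum_mul_sum]
  simp only [fourier_sub_index]

theorem integral_norm_sq_sum_fourier (ν : Measure UnitAddCircle) [IsFiniteMeasure ν]
    {ι : Type*} (s : Finset ι) (n : ι → ℤ) :
    ((∫ x, ‖∑ j ∈ s, fourier (n j) x‖ ^ 2 ∂ν : ℝ) : ℂ) =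
      ∑ j ∈ s, ∑ k ∈ s, fourierStieltjes ν (n j - n k) := by
  rw [← integral_complex_ofReal]
  simp only [norm_sq_sum_fourier, fourierStieltjes]
  rw [integral_finsetSum _ fun j _ => integrable_finsetSum _ fun k _ => integrable_fourier ν _]
  refine Finset.sum_congr rfl fun j _ => ?_
  rw [integral_finsetSum _ fun k _ => integrable_fourier ν _]

theorem integral_integral_fourier_sub (ν : Measure UnitAddCircle) [IsFiniteMeasure ν] (m : ℤ) :
    ∫ x, ∫ y, fourier m (x - y) ∂ν ∂ν = ((‖fourierStieltjes ν m‖ ^ 2 : ℝ) : ℂ) := by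
  simp only [fourier_sub_apply, integral_const_mul, integral_mul_const, integral_conj]
  rw [← fourierStieltjes, Complex.mul_conj']
  push_cast
  rfl

theorem sum_norm_sq_fourierStieltjes_sub (ν : Measure UnitAddCircle) [IsFiniteMeasure ν]
    {ι : Type*} (s : Finset ι) (n : ι → ℤ) :
    ∑ j ∈ s, ∑ k ∈ s, ‖fourierStieltjes ν (n j - n k)‖ ^ 2 =
      ∫ x, ∫ y, ‖∑ j ∈ s, fourier (n j) (x - y)‖ ^ 2 ∂ν ∂ν := by
  have hy : ∀ (m : ℤ) (x : UnitAddCircle), Integrable (fun y => fourier m (x - y)) ν :=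
    fun m x => Continuous.integrable_of_hasCompactSupport (by fun_prop)
      (HasCompactSupport.of_compactSpace _)
  have hx : ∀ m : ℤ, Integrable (fun x => ∫ y, fourier m (x - y) ∂ν) ν := fun m => by
    simp only [fourier_sub_apply, integral_const_mul]
    exact (integrable_fourier ν m).mul_const _
  apply Complex.ofReal_injective
  rw [← integral_complex_ofReal]
  simp only [← integral_complex_ofReal, norm_sq_sum_fourier]
  have h1 : ∀ x, ∫ y, ∑ j ∈ s, ∑ k ∈ s, fourier (n j - n k) (x - y) ∂ν =
      ∑ j ∈ s, ∑ k ∈ s, ∫ y, fourier (n j - n k) (x - y) ∂ν := fun x => by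
    rw [integral_finsetSum _ fun j _ => integrable_finsetSum _ fun k _ => hy _ x]
    exact Finset.sum_congr rfl fun j _ => integral_finsetSum _ fun k _ => hy _ x
  simp only [h1]
  rw [integral_finsetSum _ fun j _ => integrable_finsetSum _ fun k _ => hx _, Complex.ofReal_sum]
  refine Finset.sum_congr rfl fun j _ => ?_
  rw [integral_finsetSum _ fun k _ => hx _, Complex.ofReal_sum]
  exact Finset.sum_congr rfl fun k _ => (integral_integral_fourier_sub ν _).symm

/-- For a representative `|s| ≤ 1 / 2` the right side is `2 |sin (π s)|`, and Jordan's inequality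
applies. -/
theorem four_mul_norm_le_norm_fourier_one_sub_one (t : UnitAddCircle) :
    4 * ‖t‖ ≤ ‖fourier 1 t - 1‖ := by
  obtain ⟨s, hs, rfl⟩ : ∃ s : ℝ, |s| ≤ 1 / 2 ∧ (s : UnitAddCircle) = t := by
    induction t using QuotientAddGroup.induction_on with
    | H s =>
      refine ⟨s - round s, abs_sub_round s, ?_⟩
      exact QuotientAddGroup.eq_iff_sub_mem.2 ⟨-round s, by simp⟩
  have hn : ‖(s : UnitAddCircle)‖ = |s| :=
    (AddCircle.norm_coe_eq_abs_iff (p := 1) one_ne_zero).2 (by rwa [abs_one])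
  have he : fourier 1 (s : UnitAddCircle) =
      Complex.exp (Complex.I * ((2 * Real.pi * s : ℝ) : ℂ)) := by
    rw [fourier_coe_apply]
    congr 1
    push_cast
    ring
  have hpi := Real.pi_pos
  have habs : |2 * Real.pi * s / 2| = Real.pi * |s| := by
    rw [mul_assoc, mul_div_cancel_left₀ _ two_ne_zero, abs_mul, abs_of_pos hpi]
  have hsin := Real.mul_abs_le_abs_sin (x := 2 * Real.pi * s / 2) (by rw [habs]; nlinarith)
  rw [habs, ← mul_assoc, div_mul_cancel₀ _ hpi.ne'] at hsin
  rw [he, Complex.norm_exp_I_mul_ofReal_sub_one, hn, norm_mul, Real.norm_eq_abs, Real.norm_eq_abs,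
    abs_two]
  linarith

theorem norm_sum_range_fourier_mul_le (L : ℕ) (t : UnitAddCircle) :
    ‖∑ j ∈ Finset.range L, fourier (j : ℤ) t‖ * (2 * ‖t‖) ≤ 1 := by
  have hpow : ∀ j : ℕ, fourier (j : ℤ) t = (fourier 1 t) ^ j := fun j => by
    induction j with
    | zero => simp
    | succ j ih => rw [Nat.cast_succ, fourier_add, ih, pow_succ]
  have h := congrArg norm (geom_sum_mul (fourier 1 t) L)
  rw [norm_mul] at h
  have h2 : ‖fourier 1 t ^ L - 1‖ ≤ 2 := by
    refine (norm_sub_le _ _).trans ?_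
    rw [norm_pow, norm_fourier_apply]
    norm_num
  have h3 := four_mul_norm_le_norm_fourier_one_sub_one t
  simp only [hpow]
  have h4 := mul_le_mul_of_nonneg_left h3 (norm_nonneg (∑ j ∈ Finset.range L, fourier 1 t ^ j))
  linarith

/-- The Dirichlet kernel is at most `L` near the diagonal and, by the geometric sum, at most `1 / (2
* r)` at distance more than `r`. -/
theorem norm_sq_sum_range_fourier_le (L : ℕ) {r : ℝ} (hr : 0 < r) (x y : UnitAddCircle) :
    ‖∑ j ∈ Finset.range L, fourier (j : ℤ) (x - y)‖ ^ 2 ≤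
      (Metric.closedBall x r).indicator (fun _ => (L : ℝ) ^ 2) y + 1 / (4 * r ^ 2) := by
  by_cases hy : y ∈ Metric.closedBall x r
  · rw [Set.indicator_of_mem hy]
    have h1 : ‖∑ j ∈ Finset.range L, fourier (j : ℤ) (x - y)‖ ≤ L := by
      refine (norm_sum_le_of_le _ fun j _ => (norm_fourier_apply _ _).le).trans ?_
      simp
    have h2 := pow_le_pow_left₀ (norm_nonneg _) h1 2
    have : 0 ≤ 1 / (4 * r ^ 2) := by positivity
    linarith
  · rw [Set.indicator_of_notMem hy, zero_add]
    have hxy : r < ‖x - y‖ := by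
      rw [← dist_eq_norm, dist_comm]
      exact not_le.1 hy
    have h1 := norm_sum_range_fourier_mul_le L (x - y)
    have h2 : ‖∑ j ∈ Finset.range L, fourier (j : ℤ) (x - y)‖ * (2 * r) ≤ 1 :=
      (mul_le_mul_of_nonneg_left (by linarith) (norm_nonneg _)).trans h1
    have h3 := pow_le_pow_left₀ (by positivity) h2 2
    rw [le_div_iff₀ (by positivity)]
    nlinarith

theorem sum_range_norm_sq_fourierStieltjes_sub_le (ν : Measure UnitAddCircle)
    [IsProbabilityMeasure ν] (L : ℕ) {r K : ℝ} (hr : 0 < r)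
    (hK : ∀ x, ν.real (Metric.closedBall x r) ≤ K) :
    ∑ j ∈ Finset.range L, ∑ k ∈ Finset.range L,
      ‖fourierStieltjes ν ((j : ℤ) - (k : ℤ))‖ ^ 2 ≤ L ^ 2 * K + 1 / (4 * r ^ 2) := by
  rw [sum_norm_sq_fourierStieltjes_sub ν (Finset.range L) (fun j : ℕ => (j : ℤ))]
  have hball : ∀ x : UnitAddCircle, MeasurableSet (Metric.closedBall x r) :=
    fun x => Metric.isClosed_closedBall.measurableSet
  have hinner : ∀ x, ∫ y, ‖∑ j ∈ Finset.range L, fourier (j : ℤ) (x - y)‖ ^ 2 ∂ν ≤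
      L ^ 2 * K + 1 / (4 * r ^ 2) := fun x => by
    have hi : Integrable ((Metric.closedBall x r).indicator fun _ => (L : ℝ) ^ 2) ν :=
      (integrable_const _).indicator (hball x)
    calc _ ≤ ∫ y, ((Metric.closedBall x r).indicator (fun _ => (L : ℝ) ^ 2) y
          + 1 / (4 * r ^ 2)) ∂ν := by
          refine integral_mono_of_nonneg (ae_of_all _ fun y => by positivity)
            (hi.add (integrable_const _)) (ae_of_all _ fun y => ?_)
          exact norm_sq_sum_range_fourier_le L hr x y
      _ = L ^ 2 * ν.real (Metric.closedBall x r) + 1 / (4 * r ^ 2) := by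
          rw [integral_add hi (integrable_const _), integral_indicator_const _ (hball x)]
          simp [mul_comm]
      _ ≤ _ := by
          have := hK x
          gcongr
  refine (integral_mono_of_nonneg (ae_of_all _ fun x => integral_nonneg fun y => by positivity)
    (integrable_const (L ^ 2 * K + 1 / (4 * r ^ 2))) (ae_of_all _ hinner)).trans ?_
  simp

/-- Each `m` with `|m| ≤ M` is a difference `k - j` in at least `M` ways: for every `j` in `[M, 2 *
M)`, the index `k = m + j` lies in `[0, 3 * M]`. -/
theorem mul_sum_le_sum_range_sub {g : ℤ → ℝ} (hg : ∀ m, 0 ≤ g m) {M : ℕ} {F : Finset ℤ}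
    (hF : ∀ m ∈ F, |m| ≤ M) :
    M * ∑ m ∈ F, g m ≤
      ∑ j ∈ Finset.range (3 * M), ∑ k ∈ Finset.range (3 * M + 1), g ((k : ℤ) - (j : ℤ)) := by
  have h1 : ∀ j ∈ Finset.Ico M (2 * M),
      ∑ m ∈ F, g m ≤ ∑ k ∈ Finset.range (3 * M + 1), g ((k : ℤ) - (j : ℤ)) := by
    intro j hj
    rw [Finset.mem_Ico] at hj
    have hinj : Set.InjOn (fun m : ℤ => (m + j).toNat) F := by
      intro m hm m' hm' h
      have := abs_le.1 (hF m hm)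
      have := abs_le.1 (hF m' hm')
      simp only at h
      omega
    calc ∑ m ∈ F, g m = ∑ k ∈ F.image (fun m : ℤ => (m + j).toNat), g ((k : ℤ) - (j : ℤ)) := by
          rw [Finset.sum_image hinj]
          refine Finset.sum_congr rfl fun m hm => ?_
          have := abs_le.1 (hF m hm)
          congr 1
          omega
      _ ≤ _ := by
          refine Finset.sum_le_sum_of_subset_of_nonneg ?_ fun _ _ _ => hg _
          intro k hk
          obtain ⟨m, hm, rfl⟩ := Finset.mem_image.1 hk
          have := abs_le.1 (hF m hm)
          rw [Finset.mem_range]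
          omega
  calc M * ∑ m ∈ F, g m = ∑ _j ∈ Finset.Ico M (2 * M), ∑ m ∈ F, g m := by
        rw [Finset.sum_const, Nat.card_Ico, nsmul_eq_mul]
        congr 2
        omega
    _ ≤ ∑ j ∈ Finset.Ico M (2 * M), ∑ k ∈ Finset.range (3 * M + 1), g ((k : ℤ) - (j : ℤ)) :=
        Finset.sum_le_sum h1
    _ ≤ _ := by
        refine Finset.sum_le_sum_of_subset_of_nonneg ?_ fun _ _ _ =>
          Finset.sum_nonneg fun _ _ => hg _
        intro j hj
        rw [Finset.mem_Ico] at hj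
        rw [Finset.mem_range]
        omega

/-- Wiener-type bound: the Fourier–Stieltjes coefficients of a Frostman measure are small in
quadratic mean. -/
theorem sum_norm_sq_fourierStieltjes_le {ν : Measure UnitAddCircle} [IsProbabilityMeasure ν]
    {C s : ℝ} (hC : 0 ≤ C) (hs1 : s ≤ 1)
    (hν : ∀ (x : UnitAddCircle) (δ : ℝ), 0 < δ → ν.real (Metric.closedBall x δ) ≤ C * δ ^ s)
    {M : ℕ} (hM : 1 ≤ M) {F : Finset ℤ} (hF : ∀ m ∈ F, |m| ≤ M) :
    ∑ m ∈ F, ‖fourierStieltjes ν m‖ ^ 2 ≤ (16 * C + 1) * (M : ℝ) ^ (1 - s / 2) := by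
  have hM1 : (1 : ℝ) ≤ M := by exact_mod_cast hM
  have hM0 : (0 : ℝ) < M := by linarith
  -- With this radius the far part `1 / (4 * r ^ 2)` is only `M / 4`, while the near part is of
  -- order `M ^ (2 - s / 2)`; division by `M` then gives the bound.
  set r : ℝ := (M : ℝ) ^ (-(1 / 2) : ℝ) with hrdef
  have hr : 0 < r := Real.rpow_pos_of_pos hM0 _
  have hr2 : r ^ 2 = (M : ℝ)⁻¹ := by
    rw [hrdef, ← Real.rpow_natCast, ← Real.rpow_mul hM0.le, ← Real.rpow_neg_one]
    norm_num
  have hrs : r ^ s = (M : ℝ) ^ (-(s / 2)) := by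
    rw [hrdef, ← Real.rpow_mul hM0.le]
    congr 1
    ring
  have h1 := mul_sum_le_sum_range_sub (g := fun m => ‖fourierStieltjes ν m‖ ^ 2)
    (fun m => by positivity) hF
  have h2 : ∑ j ∈ Finset.range (3 * M), ∑ k ∈ Finset.range (3 * M + 1),
      ‖fourierStieltjes ν ((k : ℤ) - (j : ℤ))‖ ^ 2 ≤
      ∑ j ∈ Finset.range (3 * M + 1), ∑ k ∈ Finset.range (3 * M + 1),
      ‖fourierStieltjes ν ((k : ℤ) - (j : ℤ))‖ ^ 2 :=
    Finset.sum_le_sum_of_subset_of_nonneg (Finset.range_mono (by omega))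
      fun _ _ _ => Finset.sum_nonneg fun _ _ => by positivity
  rw [Finset.sum_comm (s := Finset.range (3 * M + 1))] at h2
  have h3 := sum_range_norm_sq_fourierStieltjes_sub_le ν (3 * M + 1) hr (fun x => hν x r hr)
  rw [hr2, hrs] at h3
  have h4 : (((3 * M + 1 : ℕ) : ℝ)) ^ 2 ≤ 16 * (M : ℝ) ^ 2 := by
    push_cast
    nlinarith
  have h5 : (M : ℝ) ^ (1 - s / 2) = M * (M : ℝ) ^ (-(s / 2)) := by
    rw [sub_eq_add_neg, Real.rpow_add hM0, Real.rpow_one]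
  have h6 : (1 : ℝ) ≤ (M : ℝ) ^ (1 - s / 2) := Real.one_le_rpow hM1 (by linarith)
  have h7 : (((3 * M + 1 : ℕ) : ℝ)) ^ 2 * (C * (M : ℝ) ^ (-(s / 2))) ≤
      16 * (M : ℝ) ^ 2 * (C * (M : ℝ) ^ (-(s / 2))) :=
    mul_le_mul_of_nonneg_right h4 (by positivity)
  have h8 : 1 / (4 * (M : ℝ)⁻¹) ≤ M * (M : ℝ) ^ (1 - s / 2) := by
    have : 1 / (4 * (M : ℝ)⁻¹) = M / 4 := by field_simp
    rw [this]
    nlinarith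
  have h9 : 16 * (M : ℝ) ^ 2 * (C * (M : ℝ) ^ (-(s / 2))) =
      M * (16 * C * (M : ℝ) ^ (1 - s / 2)) := by
    rw [h5]
    ring
  refine le_of_mul_le_mul_left ?_ hM0
  calc _ ≤ _ := h1.trans (h2.trans h3)
    _ ≤ M * (16 * C * (M : ℝ) ^ (1 - s / 2)) + M * (M : ℝ) ^ (1 - s / 2) := by
        rw [← h9]
        exact add_le_add h7 h8
    _ = _ := by ring

/-! ### Exponential sums along a sequence with bounded gaps -/

theorem abs_sub_le_mul_of_abs_succ_sub_le {n : ℕ → ℤ} {d N : ℕ}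
    (hd : ∀ k, |n (k + 1) - n k| ≤ d) {j k : ℕ} (hj : j < N) (hk : k < N) :
    |n j - n k| ≤ ((d * N : ℕ) : ℤ) := by
  have key : ∀ i l : ℕ, |n (i + l) - n i| ≤ (d : ℤ) * l := by
    intro i l
    induction l with
    | zero => simp
    | succ l ih =>
      have := abs_sub_le (n (i + (l + 1))) (n (i + l)) (n i)
      have := hd (i + l)
      rw [← add_assoc] at *
      push_cast
      linarith
  have hmono : ∀ l : ℕ, l ≤ N → (d : ℤ) * l ≤ ((d * N : ℕ) : ℤ) := fun l hl => by
    exact_mod_cast Nat.mul_le_mul_left d hl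
  rcases le_total j k with h | h
  · obtain ⟨l, rfl⟩ := Nat.exists_eq_add_of_le h
    rw [abs_sub_comm]
    exact (key j l).trans (hmono l (by omega))
  · obtain ⟨l, rfl⟩ := Nat.exists_eq_add_of_le h
    exact (key k l).trans (hmono l (by omega))

theorem integral_norm_sq_sum_fourier_le {ν : Measure UnitAddCircle} [IsProbabilityMeasure ν]
    {C s : ℝ} (hC : 0 ≤ C) (hs1 : s ≤ 1)
    (hν : ∀ (x : UnitAddCircle) (δ : ℝ), 0 < δ → ν.real (Metric.closedBall x δ) ≤ C * δ ^ s)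
    {n : ℕ → ℤ} (hn : Function.Injective n) {d : ℕ} (hd1 : 1 ≤ d)
    (hd : ∀ k, |n (k + 1) - n k| ≤ d) {N : ℕ} (hN : 1 ≤ N) :
    ∫ x, ‖∑ k ∈ Finset.range N, fourier (n k) x‖ ^ 2 ∂ν ≤
      √((16 * C + 1) * (d : ℝ) ^ (1 - s / 2)) * (N : ℝ) ^ (2 - s / 4) := by
  have hN0 : (0 : ℝ) < N := by exact_mod_cast hN
  set K := (16 * C + 1) * (d : ℝ) ^ (1 - s / 2) with hK
  have hK0 : 0 ≤ K := by positivity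
  have hrow : ∀ j ∈ Finset.range N,
      ∑ k ∈ Finset.range N, ‖fourierStieltjes ν (n j - n k)‖ ≤ √K * (N : ℝ) ^ (1 - s / 4) := by
    intro j hj
    have hinj : Set.InjOn (fun k => n j - n k) (Finset.range N) := fun k _ k' _ h =>
      hn (sub_right_injective h)
    have h1 : ∑ k ∈ Finset.range N, ‖fourierStieltjes ν (n j - n k)‖ ^ 2 ≤
        K * (N : ℝ) ^ (1 - s / 2) := by
      rw [← Finset.sum_image (f := fun m => ‖fourierStieltjes ν m‖ ^ 2) hinj]
      refine (sum_norm_sq_fourierStieltjes_le hC hs1 hν (M := d * N)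
        (Nat.mul_pos hd1 hN) ?_).trans ?_
      · intro m hm
        obtain ⟨k, hk, rfl⟩ := Finset.mem_image.1 hm
        exact abs_sub_le_mul_of_abs_succ_sub_le hd (Finset.mem_range.1 hj) (Finset.mem_range.1 hk)
      · rw [Nat.cast_mul, Real.mul_rpow (Nat.cast_nonneg _) (Nat.cast_nonneg _), ← mul_assoc]
    -- Cauchy–Schwarz turns the quadratic bound into a bound on the row sum of absolute values,
    -- halving the gain from `s / 2` to `s / 4`.
    have h2 := sq_sum_le_card_mul_sum_sq (s := Finset.range N)
      (f := fun k => ‖fourierStieltjes ν (n j - n k)‖)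
    rw [Finset.card_range] at h2
    refine le_of_sq_le_sq (h2.trans ?_) (by positivity)
    rw [mul_pow, Real.sq_sqrt hK0, ← Real.rpow_natCast, ← Real.rpow_mul hN0.le]
    calc (N : ℝ) * _ ≤ N * (K * (N : ℝ) ^ (1 - s / 2)) := mul_le_mul_of_nonneg_left h1 hN0.le
      _ = K * ((N : ℝ) ^ (1 : ℝ) * (N : ℝ) ^ (1 - s / 2)) := by rw [Real.rpow_one]; ring
      _ = _ := by
        rw [← Real.rpow_add hN0]
        congr 2
        push_cast
        ring
  have h0 : 0 ≤ ∫ x, ‖∑ k ∈ Finset.range N, fourier (n k) x‖ ^ 2 ∂ν :=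
    integral_nonneg fun x => by positivity
  have h := congrArg norm (integral_norm_sq_sum_fourier ν (Finset.range N) n)
  rw [Complex.norm_real, Real.norm_of_nonneg h0] at h
  rw [h]
  calc _ ≤ ∑ j ∈ Finset.range N, ∑ k ∈ Finset.range N, ‖fourierStieltjes ν (n j - n k)‖ :=
        norm_sum_le_of_le _ fun j _ => norm_sum_le _ _
    _ ≤ ∑ _j ∈ Finset.range N, √K * (N : ℝ) ^ (1 - s / 4) := Finset.sum_le_sum hrow
    _ = √K * ((N : ℝ) ^ (1 : ℝ) * (N : ℝ) ^ (1 - s / 4)) := by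
        rw [Finset.sum_const, Finset.card_range, nsmul_eq_mul, Real.rpow_one]
        ring
    _ = _ := by
        rw [← Real.rpow_add hN0]
        congr 2
        ring

/-! ### Almost everywhere convergence -/

theorem ae_tendsto_zero_of_summable_integral {α : Type*} [MeasurableSpace α] {μ : Measure α}
    {f : ℕ → α → ℝ} (hf0 : ∀ i x, 0 ≤ f i x) (hf : ∀ i, Integrable (f i) μ)
    (hsum : Summable fun i => ∫ x, f i x ∂μ) :
    ∀ᵐ x ∂μ, Tendsto (fun i => f i x) atTop (𝓝 0) := by
  have hm : ∀ i, AEMeasurable (fun x => ENNReal.ofReal (f i x)) μ :=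
    fun i => (hf i).aemeasurable.ennreal_ofReal
  have h : ∫⁻ x, ∑' i, ENNReal.ofReal (f i x) ∂μ ≠ ∞ := by
    rw [lintegral_tsum hm]
    simp only [← ofReal_integral_eq_lintegral_ofReal (hf _) (ae_of_all _ (hf0 _))]
    exact hsum.tsum_ofReal_ne_top
  filter_upwards [ae_lt_top' (AEMeasurable.tsum hm) h] with x hx
  have := (ENNReal.tendsto_toReal ENNReal.zero_ne_top).comp
    (ENNReal.tendsto_atTop_zero_of_tsum_ne_top hx.ne)
  simpa [Function.comp_def, ENNReal.toReal_ofReal, hf0] using this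

/-- Adding `1` to each term makes the partial sums monotone, so averages between consecutive `⌊c ^
m⌋` are controlled up to a factor tending to `1` with `c`. -/
theorem tendsto_average_of_tendsto_average_floor_pow {a : ℕ → ℝ} (ha : ∀ k, -1 ≤ a k)
    {c : ℕ → ℝ} (hc1 : ∀ i, 1 < c i) (hc : Tendsto c atTop (𝓝 1))
    (h : ∀ i, Tendsto (fun m : ℕ => (∑ k ∈ Finset.range ⌊c i ^ m⌋₊, a k) / ⌊c i ^ m⌋₊)
      atTop (𝓝 0)) :
    Tendsto (fun N : ℕ => (∑ k ∈ Finset.range N, a k) / N) atTop (𝓝 0) := by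
  have hshift : ∀ N : ℕ, 0 < N → (∑ k ∈ Finset.range N, (a k + 1)) / (N : ℝ) =
      (∑ k ∈ Finset.range N, a k) / N + 1 := fun N hN => by
    have : (N : ℝ) ≠ 0 := by exact_mod_cast hN.ne'
    rw [Finset.sum_add_distrib, Finset.sum_const, Finset.card_range, nsmul_eq_mul, mul_one,
      add_div, div_self this]
  have key := tendsto_div_of_monotone_of_tendsto_div_floor_pow
    (fun N => ∑ k ∈ Finset.range N, (a k + 1)) 1 ?_ c hc1 hc ?_
  · have := key.sub_const 1
    rw [sub_self] at this
    refine this.congr' ?_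
    filter_upwards [eventually_gt_atTop 0] with N hN
    rw [hshift N hN, add_sub_cancel_right]
  · refine monotone_nat_of_le_succ fun N => ?_
    rw [Finset.sum_range_succ]
    linarith [ha N]
  · intro i
    have := (h i).add_const 1
    rw [zero_add] at this
    refine this.congr fun m => (hshift _ ?_).symm
    exact Nat.floor_pos.2 (one_le_pow₀ (hc1 i).le)

theorem summable_floor_pow_rpow_neg {c η : ℝ} (hc : 1 < c) (hη : 0 < η) :
    Summable fun m : ℕ => (⌊c ^ m⌋₊ : ℝ) ^ (-η) := by
  have hc0 : 0 < c := by linarith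
  have hgeom : Summable fun m : ℕ => (2 : ℝ) ^ η * (c ^ (-η)) ^ m :=
    (summable_geometric_of_lt_one (by positivity)
      (Real.rpow_lt_one_of_one_lt_of_neg hc (by linarith))).mul_left _
  refine Summable.of_nonneg_of_le (fun m => by positivity) (fun m => ?_) hgeom
  have h1 : (1 : ℝ) ≤ c ^ m := one_le_pow₀ hc.le
  have h2 : c ^ m / 2 ≤ (⌊c ^ m⌋₊ : ℝ) := by
    have h3 := Nat.lt_floor_add_one (c ^ m)
    have h4 : (1 : ℝ) ≤ (⌊c ^ m⌋₊ : ℝ) := by exact_mod_cast Nat.floor_pos.2 h1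
    linarith
  calc (⌊c ^ m⌋₊ : ℝ) ^ (-η) ≤ (c ^ m / 2) ^ (-η) :=
        Real.rpow_le_rpow_of_nonpos (by positivity) h2 (by linarith)
    _ = _ := by
        rw [Real.div_rpow (by positivity) (by norm_num), Real.rpow_neg zero_le_two, div_inv_eq_mul,
          mul_comm, ← Real.rpow_natCast, ← Real.rpow_natCast, ← Real.rpow_mul hc0.le,
          ← Real.rpow_mul hc0.le, mul_comm (m : ℝ)]

/-- Along a sequence with bounded gaps, the exponential averages vanish almost everywhere for a
Frostman measure. -/
theorem ae_tendsto_average_fourier {ν : Measure UnitAddCircle} [IsProbabilityMeasure ν]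
    {C s : ℝ} (hC : 0 ≤ C) (hs : 0 < s) (hs1 : s ≤ 1)
    (hν : ∀ (x : UnitAddCircle) (δ : ℝ), 0 < δ → ν.real (Metric.closedBall x δ) ≤ C * δ ^ s)
    {n : ℕ → ℤ} (hn : Function.Injective n) {d : ℕ} (hd1 : 1 ≤ d)
    (hd : ∀ k, |n (k + 1) - n k| ≤ d) :
    ∀ᵐ x ∂ν, Tendsto (fun N : ℕ => (N : ℂ)⁻¹ * ∑ k ∈ Finset.range N, fourier (n k) x)
      atTop (𝓝 0) := by
  -- Countably many ratios decreasing to `1` suffice, so the exceptional null sets can be united.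
  set c : ℕ → ℝ := fun i => 1 + 1 / ((i : ℝ) + 1) with hc
  have hc1 : ∀ i, 1 < c i := fun i => by
    have : (0 : ℝ) < 1 / ((i : ℝ) + 1) := by positivity
    simp only [hc]
    linarith
  have hclim : Tendsto c atTop (𝓝 1) := by
    simpa [hc] using tendsto_one_div_add_atTop_nhds_zero_nat.const_add (1 : ℝ)
  have hae : ∀ i, ∀ᵐ x ∂ν, Tendsto (fun m : ℕ =>
      (‖∑ k ∈ Finset.range ⌊c i ^ m⌋₊, fourier (n k) x‖ / ⌊c i ^ m⌋₊) ^ 2) atTop (𝓝 0) := by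
    intro i
    refine ae_tendsto_zero_of_summable_integral (fun m x => by positivity) (fun m => ?_) ?_
    · exact Continuous.integrable_of_hasCompactSupport (by fun_prop)
        (HasCompactSupport.of_compactSpace _)
    · refine Summable.of_nonneg_of_le (fun m => integral_nonneg fun x => by positivity)
        (fun m => ?_) ((summable_floor_pow_rpow_neg (hc1 i) (η := s / 4) (by linarith)).mul_left
          (√((16 * C + 1) * (d : ℝ) ^ (1 - s / 2))))
      have hN : 1 ≤ ⌊c i ^ m⌋₊ := Nat.floor_pos.2 (one_le_pow₀ (hc1 i).le)
      have hN0 : (0 : ℝ) < ⌊c i ^ m⌋₊ := by exact_mod_cast hN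
      simp only [div_pow]
      rw [integral_div, div_le_iff₀ (by positivity)]
      refine (integral_norm_sq_sum_fourier_le hC hs1 hν hn hd1 hd hN).trans_eq ?_
      rw [mul_assoc, ← Real.rpow_natCast _ 2, ← Real.rpow_add hN0]
      congr 2
      push_cast
      ring
  filter_upwards [ae_all_iff.2 hae] with x hx
  have hnorm : ∀ i, Tendsto (fun m : ℕ =>
      ‖∑ k ∈ Finset.range ⌊c i ^ m⌋₊, fourier (n k) x‖ / ⌊c i ^ m⌋₊) atTop (𝓝 0) := fun i => by
    have := (Real.continuous_sqrt.tendsto 0).comp (hx i)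
    rw [Real.sqrt_zero] at this
    refine this.congr fun m => ?_
    exact Real.sqrt_sq (by positivity)
  -- The interpolation between the `⌊c ^ m⌋` needs real terms bounded below by `-1`; real and
  -- imaginary parts are treated alike.
  have hpart : ∀ φ : ℂ →ₗ[ℝ] ℝ, (∀ z, |φ z| ≤ ‖z‖) →
      Tendsto (fun N : ℕ => (∑ k ∈ Finset.range N, φ (fourier (n k) x)) / (N : ℝ))
        atTop (𝓝 0) := by
    intro φ hφ
    refine tendsto_average_of_tendsto_average_floor_pow (fun k => ?_) hc1 hclim fun i => ?_
    · have := hφ (fourier (n k) x)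
      rw [norm_fourier_apply] at this
      exact (abs_le.1 this).1
    · refine squeeze_zero_norm (fun m => ?_) (hnorm i)
      rw [← map_sum, Real.norm_eq_abs, abs_div, Nat.abs_cast]
      exact div_le_div_of_nonneg_right (hφ _) (Nat.cast_nonneg _)
  have hre := hpart Complex.reLm Complex.abs_re_le_norm
  have him := hpart Complex.imLm Complex.abs_im_le_norm
  have := ((Complex.continuous_ofReal.tendsto 0).comp hre).add
    (((Complex.continuous_ofReal.tendsto 0).comp him).mul_const Complex.I)
  simp only [Complex.ofReal_zero, zero_mul, add_zero] at this
  refine this.congr fun N => ?_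
  simp only [Function.comp, ← map_sum, Complex.ofReal_div, Complex.ofReal_natCast]
  conv_rhs => rw [← Complex.re_add_im (∑ k ∈ Finset.range N, fourier (n k) x)]
  simp only [Complex.reLm_coe, Complex.imLm_coe]
  ring

/-! ### Conclusion -/

theorem proposition6 (ν : Measure UnitAddCircle) [IsProbabilityMeasure ν]
    (hν : IsHyperboundedConv ν) (n : ℕ → ℕ) (hpos : ∀ k, 0 < n k)
    (hinj : Function.Injective n) (hgaps : HasBoundedGaps n) :
    ∀ᵐ x ∂ν, ∀ t : ℝ, (t : UnitAddCircle) = x →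
      UniformlyDistributedMod1 (fun k => (n k : ℝ) * t) := by
  obtain ⟨C, s, hC, hs, hs1, hF⟩ := hν.exists_measureReal_closedBall_le_of_pos
  obtain ⟨d, hd⟩ := hgaps
  have hae : ∀ m : ℤ, m ≠ 0 → ∀ᵐ x ∂ν,
      Tendsto (fun N : ℕ => (N : ℂ)⁻¹ * ∑ k ∈ Finset.range N, fourier (m * n k) x)
        atTop (𝓝 0) := by
    intro m hm
    refine ae_tendsto_average_fourier hC hs hs1 hF (n := fun k => m * n k)
      -- The gaps of `m * n k` are at most `|m| * d`; the `+ 1` secures `1 ≤ d` without ruling out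
      -- `d = 0`.
      (d := m.natAbs * d + 1) (fun j k h => hinj ?_) (by omega) fun k => ?_
    · exact_mod_cast mul_left_cancel₀ hm h
    · rw [← mul_sub, abs_mul]
      push_cast
      have := mul_le_mul_of_nonneg_left (hd k) (abs_nonneg m)
      linarith
  have hall : ∀ᵐ x ∂ν, ∀ m : ℤ, m ≠ 0 →
      Tendsto (fun N : ℕ => (N : ℂ)⁻¹ * ∑ k ∈ Finset.range N, fourier (m * n k) x)
        atTop (𝓝 0) := by
    rw [ae_all_iff]
    intro m
    by_cases hm : m = 0
    · exact ae_of_all _ fun x h => absurd hm h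
    · filter_upwards [hae m hm] with x hx _ using hx
  filter_upwards [hall] with x hx t htx
  refine uniformlyDistributedMod1_of_tendsto_fourier fun m hm => ?_
  refine (hx m hm).congr fun N => ?_
  congr 1
  refine Finset.sum_congr rfl fun k _ => ?_
  have : (((n k : ℝ) * t : ℝ) : UnitAddCircle) = (n k : ℤ) • x := by
    rw [← htx, natCast_zsmul, ← AddCircle.coe_nsmul, nsmul_eq_mul]
  rw [this, fourier_apply, fourier_apply, mul_smul]
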